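/- Let $\mathcal F=\bigoplus_{n\ge 0}L^2(\mathbb R_+^n)$ be the full Fock space over $L^2(\mathbb R_+)$ (with $L^2(\mathbb R_+)^{\otimes n}=L^2(\mathbb R_+^n)$), $\Omega$ its vacuum vector, $l(h)$ the left creation operator, and $S(h)=l(h)+l(h)^*$ for $h\in L^2_{\mathbb R}(\mathbb R_+)$. Let $\mathcal{SC}=\{S(h)\}''$, with the trace $\tau(X)=\langle\Omega,X\Omega\rangle$, let $\mathcal{SC}_{alg}$ be the unital $*$-algebra generated by the $S(h)$, and let $I_n:L^2(\mathbb R_+^n)\to L^2(\mathcal{SC})$ be the $n$-th multiple Wigner integral, i.e. the continuous linear extension of $\mathbf 1_{[u_1,v_1]\times\cdots\times[u_n,v_n]}\mapsto (S_{v_1}-S_{u_1})\cdots(S_{v_n}-S_{u_n})$, where $S_t=S(\mathbf 1_{[0,t]})$, from boxes that do not meet the diagonals. Put $\mathbb M_2^{k,k+1}=L^2(\mathbb R_+^k,L^2(\mathcal{SC}^{\otimes(k+1)},\tau^{\otimes(k+1)}))$. On $\mathcal{SC}_{alg}$ let $\nabla=(\nabla_t)_{t\ge0}$ be the free Malliavin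 derivative, i.e. the derivation with $\nabla_tS(h)=h(t)\,1\otimes 1$ and $\nabla_t(AB)=A\cdot\nabla_tB+\nabla_tA\cdot B$, let $\nabla^k_{t_1,\dots,t_k}=(\mathrm{id}^{\otimes(k-1)}\otimes\nabla_{t_k})\circ\cdots\circ(\mathrm{id}\otimes\nabla_{t_2})\circ\nabla_{t_1}$, and let $D^k=k!\,\nabla^k:\mathcal{SC}_{alg}\to\mathbb M_2^{k,k+1}$. Let $\mathbb D^{p,2,\sigma}\subset L^2(\mathcal{SC})$ be the set of $L^2$-limits of sequences in $\mathcal{SC}_{alg}$ that are Cauchy for the norm $\bigl(\|F\|_2^2+\sum_{j=1}^p\|D^jF\|^2_{\mathbb M_2^{j,j+1}}\bigr)^{1/2}$, and denote the closure of $D^p$ again by $D^p$. **Proposition.** Let $F=\sum_{n\ge0}I_n(f_n)\in L^2(\mathcal{SC})$ with $f_n\in L^2(\mathbb R_+^n)$, and let $p\ge1$ be an integer. Then $F\in\mathbb D^{p,2,\sigma}$ if and only if $$\sum_{n=p}^\infty n(n-1)\cdots(n-p+1)\,\|f_n\|^2_{L^2(\mathbb R_+^n)}<\infty .$$ In this case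 $D^pF$ is well defined (there is exactly one $U\in\mathbb M_2^{p,p+1}$ such that $(F,U)$ is in the closure of the graph of $D^p$ on $\mathcal{SC}_{alg}$), and $$\|D^pF\|^2_{\mathbb M_2^{p,p+1}}=p!\sum_{n=p}^\infty n(n-1)\cdots(n-p+1)\,\|f_n\|^2_{L^2(\mathbb R_+^n)} .$$ -/

import Mathlib

open MeasureTheory Filter Topology
open scoped ENNReal TensorProduct

noncomputable section

namespace Wigner

/-! ### The spaces `L²(ℝ₊ⁿ)` -/

/-- Lebesgue measure on the half-line `ℝ₊ = [0, ∞)`. -/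
def halfLine : Measure ℝ := (volume : Measure ℝ).restrict (Set.Ici 0)

instance : SigmaFinite halfLine := by unfold halfLine; infer_instance

instance : IsLocallyFiniteMeasure halfLine := by unfold halfLine; infer_instance

/-- Lebesgue measure on `ℝ₊ⁿ`. -/
def orthant (n : ℕ) : Measure (Fin n → ℝ) := Measure.pi fun _ => halfLine

instance (n : ℕ) : SigmaFinite (orthant n) := by unfold orthant; infer_instance

instance (n : ℕ) : IsLocallyFiniteMeasure (orthant n) := by unfold orthant; infer_instance

/-- The real Hilbert space `L²_ℝ(ℝ₊)`. -/
abbrev RealL2 : Type := Lp ℝ 2 halfLine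

/-- The complex Hilbert space `L²(ℝ₊ⁿ)`, i.e. the `n`-th Hilbert tensor power of `L²(ℝ₊)`. -/
abbrev ChaosL2 (n : ℕ) : Type := Lp ℂ 2 (orthant n)

/-- For `h` on `ℝ₊` and `g` on `ℝ₊ⁿ`, the function `(t₀, …, tₙ) ↦ h(t₀) g(t₁, …, tₙ)`. -/
def consMul {E : Type*} [SMul ℂ E] {n : ℕ} (h : ℝ → ℂ) (g : (Fin n → ℝ) → E) :
    (Fin (n + 1) → ℝ) → E :=
  fun t => h (t 0) • g (Fin.tail t)

theorem measurePreserving_split (n : ℕ) :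
    MeasurePreserving (fun t : Fin (n + 1) → ℝ => (t 0, Fin.tail t))
      (orthant (n + 1)) (halfLine.prod (orthant n)) := by
  have := measurePreserving_piFinSuccAbove (fun _ : Fin (n + 1) => halfLine) 0
  exact this

theorem aestronglyMeasurable_consMul {E : Type*} [NormedAddCommGroup E] [NormedSpace ℂ E] {n : ℕ}
    {h : ℝ → ℂ} {g : (Fin n → ℝ) → E} (hh : AEStronglyMeasurable h halfLine)
    (hg : AEStronglyMeasurable g (orthant n)) :
    AEStronglyMeasurable (consMul h g) (orthant (n + 1)) := by
  have h1 : AEStronglyMeasurable (fun z : ℝ × (Fin n → ℝ) => h z.1 • g z.2)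
      (halfLine.prod (orthant n)) := hh.comp_fst.smul hg.comp_snd
  exact h1.comp_measurePreserving (measurePreserving_split n)

theorem eLpNorm_smul_prod {E : Type*} [NormedAddCommGroup E] [NormedSpace ℂ E] {n : ℕ}
    {h : ℝ → ℂ} {g : (Fin n → ℝ) → E} (hh : AEStronglyMeasurable h halfLine)
    (hg : AEStronglyMeasurable g (orthant n)) {q : ℝ≥0∞} (hq0 : q ≠ 0) (hq : q ≠ ∞) :
    eLpNorm (fun z : ℝ × (Fin n → ℝ) => h z.1 • g z.2) q (halfLine.prod (orthant n))
      = eLpNorm h q halfLine * eLpNorm g q (orthant n) := by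
  simp only [eLpNorm_eq_lintegral_rpow_enorm_toReal hq0 hq]
  rw [← ENNReal.mul_rpow_of_nonneg _ _ (by positivity)]
  congr 1
  simp only [enorm_smul, ENNReal.mul_rpow_of_nonneg _ _ ENNReal.toReal_nonneg]
  exact lintegral_prod_mul (hh.enorm.pow_const _) (hg.enorm.pow_const _)

theorem eLpNorm_consMul {E : Type*} [NormedAddCommGroup E] [NormedSpace ℂ E] {n : ℕ}
    {h : ℝ → ℂ} {g : (Fin n → ℝ) → E} (hh : AEStronglyMeasurable h halfLine)
    (hg : AEStronglyMeasurable g (orthant n)) :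
    eLpNorm (consMul h g) 2 (orthant (n + 1))
      = eLpNorm h 2 halfLine * eLpNorm g 2 (orthant n) := by
  have h1 : AEStronglyMeasurable (fun z : ℝ × (Fin n → ℝ) => h z.1 • g z.2)
      (halfLine.prod (orthant n)) := hh.comp_fst.smul hg.comp_snd
  rw [← eLpNorm_smul_prod hh hg (by norm_num) (by norm_num),
    ← eLpNorm_comp_measurePreserving h1 (measurePreserving_split n)]
  rfl

theorem memLp_consMul {E : Type*} [NormedAddCommGroup E] [NormedSpace ℂ E] {n : ℕ}
    {h : ℝ → ℂ} {g : (Fin n → ℝ) → E} (hh : MemLp h 2 halfLine)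
    (hg : MemLp g 2 (orthant n)) : MemLp (consMul h g) 2 (orthant (n + 1)) := by
  refine ⟨aestronglyMeasurable_consMul hh.1 hg.1, ?_⟩
  rw [eLpNorm_consMul hh.1 hg.1]
  exact ENNReal.mul_lt_top hh.2 hg.2

/-- The elementary tensor `h ⊗ f ∈ L²(ℝ₊ⁿ⁺¹)` of `h ∈ L²(ℝ₊)` and `f ∈ L²(ℝ₊ⁿ)`. -/
def consTensor {n : ℕ} (h : Lp ℂ 2 halfLine) (f : ChaosL2 n) : ChaosL2 (n + 1) :=
  (memLp_consMul (Lp.memLp h) (Lp.memLp f)).toLp (consMul h f)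

theorem norm_consTensor {n : ℕ} (h : Lp ℂ 2 halfLine) (f : ChaosL2 n) :
    ‖consTensor h f‖ = ‖h‖ * ‖f‖ := by
  rw [consTensor, Lp.norm_toLp, eLpNorm_consMul (Lp.aestronglyMeasurable h)
    (Lp.aestronglyMeasurable f), ENNReal.toReal_mul, Lp.norm_def, Lp.norm_def]

theorem tail_quasiMeasurePreserving (n : ℕ) :
    Measure.QuasiMeasurePreserving (fun t : Fin (n + 1) → ℝ => Fin.tail t)
      (orthant (n + 1)) (orthant n) :=
  Measure.quasiMeasurePreserving_snd.comp (measurePreserving_split n).quasiMeasurePreserving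

theorem consMul_congr {E : Type*} [NormedAddCommGroup E] [NormedSpace ℂ E] {n : ℕ}
    (h : ℝ → ℂ) {g g' : (Fin n → ℝ) → E} (hg : g =ᵐ[orthant n] g') :
    consMul h g =ᵐ[orthant (n + 1)] consMul h g' := by
  filter_upwards [(tail_quasiMeasurePreserving n).ae_eq_comp hg] with t ht
  simp only [Function.comp] at ht
  simp only [consMul, ht]

theorem consTensor_add {n : ℕ} (h : Lp ℂ 2 halfLine) (f g : ChaosL2 n) :
    consTensor h (f + g) = consTensor h f + consTensor h g := by
  unfold consTensor
  rw [← MemLp.toLp_add]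
  refine MemLp.toLp_congr _ _ ((consMul_congr h (Lp.coeFn_add f g)).trans ?_)
  filter_upwards with t
  simp [consMul, mul_add]

theorem consTensor_smul {n : ℕ} (h : Lp ℂ 2 halfLine) (c : ℂ) (f : ChaosL2 n) :
    consTensor h (c • f) = c • consTensor h f := by
  unfold consTensor
  rw [← MemLp.toLp_const_smul]
  refine MemLp.toLp_congr _ _ ((consMul_congr h (Lp.coeFn_smul c f)).trans ?_)
  filter_upwards with t
  simp [consMul, mul_left_comm]

/-! ### The free Fock space and the semicircular operators -/

/-- The full Fock space `⨁ₙ L²(ℝ₊)^{⊗n}` (Hilbert direct sum), where `L²(ℝ₊)^{⊗n} = L²(ℝ₊ⁿ)`. -/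
abbrev Fock : Type := lp (fun n : ℕ => ChaosL2 n) 2

/-- Bounded operators on the full Fock space. -/
abbrev FockOp : Type := Fock →L[ℂ] Fock

/-- The vacuum vector. -/
def vacuum : Fock :=
  lp.single 2 0 (indicatorConstLp 2 MeasurableSet.univ
    (by simp [orthant]) (1 : ℂ))

/-- The components of `h ⊗ ψ` for `ψ` in the Fock space. -/
def creationFun (h : Lp ℂ 2 halfLine) (ψ : Fock) : (n : ℕ) → ChaosL2 n
  | 0 => 0
  | n + 1 => consTensor h (ψ n)

theorem creationFun_summable (h : Lp ℂ 2 halfLine) (ψ : Fock) :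
    HasSum (fun n => ‖creationFun h ψ n‖ ^ (2 : ℝ≥0∞).toReal)
      ((‖h‖ * ‖ψ‖) ^ (2 : ℝ≥0∞).toReal) := by
  have h2 : 0 < (2 : ℝ≥0∞).toReal := by norm_num
  have key := (lp.hasSum_norm h2 ψ).mul_left (‖h‖ ^ (2 : ℝ≥0∞).toReal)
  rw [← Real.mul_rpow (norm_nonneg _) (norm_nonneg _)] at key
  rw [← hasSum_nat_add_iff' 1]
  simp only [Finset.sum_range_one, creationFun, norm_zero, Real.zero_rpow h2.ne', sub_zero,
    norm_consTensor]
  simpa only [Real.mul_rpow (norm_nonneg _) (norm_nonneg _)] using key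

/-- The left creation operator `l(h)`: `l(h) ψ = h ⊗ ψ`. -/
def creation (h : Lp ℂ 2 halfLine) : FockOp :=
  LinearMap.mkContinuous
    { toFun := fun ψ => ⟨creationFun h ψ,
        memℓp_gen_iff (by norm_num) |>.2 (creationFun_summable h ψ).summable⟩
      map_add' := by
        intro ψ φ
        ext1
        funext n
        cases n with
        | zero => exact (add_zero (0 : ChaosL2 0)).symm
        | succ n => exact consTensor_add h (ψ n) (φ n)
      map_smul' := by
        intro c ψ
        ext1
        funext n
        cases n with
        | zero => exact (smul_zero (A := ChaosL2 0) c).symm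
        | succ n => exact consTensor_smul h c (ψ n) }
    ‖h‖ (by
      intro ψ
      refine lp.norm_le_of_tsum_le (by norm_num) (by positivity) ?_
      exact (creationFun_summable h ψ).tsum_eq.le)

/-- The inclusion of `L²_ℝ(ℝ₊)` in `L²(ℝ₊)`. -/
def complexify (h : RealL2) : Lp ℂ 2 halfLine := Complex.ofRealCLM.compLp h

/-- The semicircular (field) operator `S(h) = l(h) + l(h)*`, `h ∈ L²_ℝ(ℝ₊)`. -/
def field (h : RealL2) : FockOp :=
  creation (complexify h) + ContinuousLinearMap.adjoint (creation (complexify h))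

/-! ### The von Neumann algebra of the free Brownian motion and its `L²`-space -/

/-- The von Neumann algebra `{S(h) : h ∈ L²_ℝ(ℝ₊)}''`. -/
def SC : VonNeumannAlgebra Fock where
  toStarSubalgebra :=
    StarSubalgebra.centralizer ℂ (StarSubalgebra.centralizer ℂ (Set.range field) : Set FockOp)
  centralizer_centralizer' := by
    change Set.centralizer (Set.centralizer ((StarSubalgebra.centralizer ℂ
      (StarSubalgebra.centralizer ℂ (Set.range field) : Set FockOp)) : Set FockOp)) =
      ((StarSubalgebra.centralizer ℂ
      (StarSubalgebra.centralizer ℂ (Set.range field) : Set FockOp)) : Set FockOp)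
    rw [StarSubalgebra.coe_centralizer_centralizer, Set.centralizer_centralizer_centralizer]

/-- The elements of the von Neumann algebra, as a star algebra. -/
abbrev SCAlg : Type := ↥SC.toStarSubalgebra

theorem field_mem (h : RealL2) : field h ∈ SC.toStarSubalgebra :=
  StarAlgebra.adjoin_le_centralizer_centralizer ℂ _
    (StarAlgebra.subset_adjoin ℂ _ ⟨h, rfl⟩)

/-- `S(h)` as an element of the von Neumann algebra. -/
def semicircular (h : RealL2) : SCAlg := ⟨field h, field_mem h⟩

/-- The vacuum state `τ(X) = ⟨Ω, X Ω⟩`. -/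
def vacuumState (X : SCAlg) : ℂ := inner ℂ vacuum ((X : FockOp) vacuum)

/-- A copy of the von Neumann algebra, to carry the inner product of `L²(τ)`. -/
def PreL2 : Type := SCAlg

instance : AddCommGroup PreL2 := inferInstanceAs (AddCommGroup SCAlg)

instance : Module ℂ PreL2 := inferInstanceAs (Module ℂ SCAlg)

theorem vacuumState_star_mul (X Y : SCAlg) :
    vacuumState (star X * Y) = inner ℂ ((X : FockOp) vacuum) ((Y : FockOp) vacuum) := by
  change inner ℂ vacuum ((star (X : FockOp) * (Y : FockOp)) vacuum) = _
  rw [ContinuousLinearMap.star_eq_adjoint, mul_apply_eq_comp,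
    ContinuousLinearMap.adjoint_inner_right]

/-- The inner product `⟨X, Y⟩ = τ(X* Y)`. -/
instance preL2Core : PreInnerProductSpace.Core ℂ PreL2 where
  inner X Y := vacuumState (star (show SCAlg from X) * (show SCAlg from Y))
  conj_inner_symm X Y := by
    rw [vacuumState_star_mul, vacuumState_star_mul]
    exact inner_conj_symm (𝕜 := ℂ) (E := Fock) _ _
  re_inner_nonneg X := by
    rw [vacuumState_star_mul]
    exact inner_self_nonneg (𝕜 := ℂ) (E := Fock)
  add_left X Y Z := by
    rw [vacuumState_star_mul, vacuumState_star_mul, vacuumState_star_mul]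
    exact inner_add_left (𝕜 := ℂ) (E := Fock) _ _ _
  smul_left X Y c := by
    rw [vacuumState_star_mul, vacuumState_star_mul]
    exact inner_smul_left (𝕜 := ℂ) (E := Fock) _ _ _

instance : SeminormedAddCommGroup PreL2 :=
  InnerProductSpace.Core.toSeminormedAddCommGroup (𝕜 := ℂ)

instance : InnerProductSpace ℂ PreL2 := InnerProductSpace.ofCore preL2Core

/-- `L²(SC, τ)`, the completion of `SC` for the norm `τ(X* X)^{1/2}`. -/
abbrev L2SC : Type := UniformSpace.Completion PreL2

/-- The canonical map `SC → L²(SC)`. -/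
def toL2 : SCAlg →ₗ[ℂ] L2SC :=
  (UniformSpace.Completion.toComplL (𝕜 := ℂ) (E := PreL2)).toLinearMap

/-! ### Multiple Wigner integrals -/

/-- The free Brownian motion `S_t = S(1_{[0,t]})`. -/
def brownian (t : ℝ) : SCAlg :=
  semicircular (indicatorConstLp 2 (measurableSet_Icc (a := 0) (b := t))
    isCompact_Icc.measure_lt_top.ne 1)

/-- Indicator function of the box `∏ [uᵢ, vᵢ]`, as an element of `L²(ℝ₊ⁿ)`. -/
def boxIndicator {n : ℕ} (u v : Fin n → ℝ) : ChaosL2 n :=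
  indicatorConstLp 2 (measurableSet_Icc (a := u) (b := v)) isCompact_Icc.measure_lt_top.ne 1

/-- The pairs `(1_A, (S_{v₁} - S_{u₁}) ⋯ (S_{vₙ} - S_{uₙ}))` for boxes `A = ∏ [uᵢ, vᵢ]` in `ℝ₊ⁿ`
which do not meet the diagonals `{t : ∃ i ≠ j, tᵢ = tⱼ}`. -/
def boxGraph (n : ℕ) : Set (ChaosL2 n × L2SC) :=
  {z | ∃ u v : Fin n → ℝ, 0 ≤ u ∧ u ≤ v ∧ (∀ t ∈ Set.Icc u v, Function.Injective t) ∧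
    z = (boxIndicator u v, toL2 (List.ofFn fun i => brownian (v i) - brownian (u i)).prod)}

/-- `IsWignerIntegral n f X` says that `X = Iₙ(f)`: the multiple integral is extended from
off-diagonal boxes by linearity and continuity, i.e. its graph is the closed linear span of
`boxGraph n`. -/
def IsWignerIntegral (n : ℕ) (f : ChaosL2 n) (X : L2SC) : Prop :=
  (f, X) ∈ (Submodule.span ℂ (boxGraph n)).topologicalClosure

/-! ### Hilbert tensor powers and the spaces `𝕄₂^{k,k+1}` -/

/-- A bundled complex Hilbert space. -/
structure HilbertObj where
  carrier : Type
  [normedAddCommGroup : NormedAddCommGroup carrier]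
  [innerProductSpace : InnerProductSpace ℂ carrier]
  [completeSpace : CompleteSpace carrier]

attribute [instance] HilbertObj.normedAddCommGroup HilbertObj.innerProductSpace
  HilbertObj.completeSpace

/-- `tensorObj n` is the Hilbert space tensor product of `n + 1` copies of `L²(SC)`. -/
def tensorObj : ℕ → HilbertObj
  | 0 => ⟨L2SC⟩
  | n + 1 => ⟨UniformSpace.Completion (L2SC ⊗[ℂ] (tensorObj n).carrier)⟩

/-- `L²(SC^{⊗(n+1)}, τ^{⊗(n+1)})`. -/
abbrev L2Tensor (n : ℕ) : Type := (tensorObj n).carrier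

/-- `x ⊗ y ∈ L²(SC^{⊗(n+2)})`, on the algebraic tensor product `L²(SC) ⊙ L²(SC^{⊗(n+1)})`. -/
def tensorCons (n : ℕ) : L2SC ⊗[ℂ] L2Tensor n →ₗ[ℂ] L2Tensor (n + 1) :=
  (UniformSpace.Completion.toComplL (𝕜 := ℂ) (E := L2SC ⊗[ℂ] L2Tensor n)).toLinearMap

/-- `𝕄₂^{k,k+1} = L²(ℝ₊ᵏ, L²(SC^{⊗(k+1)}))`. -/
abbrev RandomField (k : ℕ) : Type := Lp (L2Tensor k) 2 (orthant k)

/-! ### The free Malliavin derivative -/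

/-- Noncommutative polynomials in the formal variables `X_h`, `h ∈ L²_ℝ(ℝ₊)`. -/
abbrev NCPoly : Type := FreeAlgebra ℂ RealL2

/-- Evaluation `P ↦ P(S)`, `X_h ↦ S(h)`. -/
def evalPoly : NCPoly →ₐ[ℂ] SCAlg := FreeAlgebra.lift ℂ semicircular

/-- The values `P(S)` are exactly the elements of the unital `*`-algebra generated by the `S(h)`. -/
theorem range_evalPoly :
    (evalPoly.range : Set SCAlg) = (StarAlgebra.adjoin ℂ (Set.range semicircular) : Set SCAlg) := by
  have hstar : star (Set.range semicircular) = Set.range semicircular := by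
    have hs : ∀ h, star (semicircular h) = semicircular h := by
      intro h
      apply Subtype.ext
      change star (field h) = field h
      rw [ContinuousLinearMap.star_eq_adjoint, field, map_add,
        ContinuousLinearMap.adjoint_adjoint, add_comm]
    ext x
    constructor
    · rintro ⟨h, hh⟩
      exact ⟨h, by rw [← hs, hh, star_star]⟩
    · rintro ⟨h, rfl⟩
      exact ⟨h, (hs h).symm⟩
  have h1 : evalPoly.range = Algebra.adjoin ℂ (Set.range semicircular) := by
    rw [evalPoly, Algebra.adjoin_range_eq_range_freeAlgebra_lift]
  rw [h1]
  change _ = ((StarAlgebra.adjoin ℂ (Set.range semicircular)).toSubalgebra : Set SCAlg)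
  rw [StarAlgebra.adjoin_toSubalgebra, hstar, Set.union_self]

/-- `P ↦ [P(S)] ∈ L²(SC)`. -/
def polyToL2 : NCPoly →ₗ[ℂ] L2SC := toL2 ∘ₗ evalPoly.toLinearMap

/-- The algebra homomorphism `P ↦ (P ⊗ 1, ∇ₜP; 0, 1 ⊗ P)` into upper triangular matrices, which
encodes the derivation `∇ₜ`. -/
def nablaMatrix (t : ℝ) : NCPoly →ₐ[ℂ] Matrix (Fin 2) (Fin 2) (NCPoly ⊗[ℂ] NCPoly) :=
  FreeAlgebra.lift ℂ fun h : RealL2 =>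
    !![FreeAlgebra.ι ℂ h ⊗ₜ 1, ((h t : ℝ) : ℂ) • (1 ⊗ₜ 1); 0, 1 ⊗ₜ FreeAlgebra.ι ℂ h]

/-- The free Malliavin derivative `∇ₜ` at time `t` (for the chosen representatives of the elements
of `L²_ℝ(ℝ₊)`): the derivation with `∇ₜ X_h = h(t) 1 ⊗ 1`, see `nablaAt_ι` and `nablaAt_mul`. -/
def nablaAt (t : ℝ) : NCPoly →ₗ[ℂ] NCPoly ⊗[ℂ] NCPoly where
  toFun P := nablaMatrix t P 0 1
  map_add' P Q := by simp
  map_smul' c P := by simp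

theorem nablaAt_ι (t : ℝ) (h : RealL2) :
    nablaAt t (FreeAlgebra.ι ℂ h) = ((h t : ℝ) : ℂ) • (1 ⊗ₜ 1) := by
  simp [nablaAt, nablaMatrix]

theorem nablaMatrix_diag (t : ℝ) (P : NCPoly) :
    nablaMatrix t P 0 0 = P ⊗ₜ 1 ∧ nablaMatrix t P 1 0 = 0 ∧ nablaMatrix t P 1 1 = 1 ⊗ₜ P := by
  induction P using FreeAlgebra.induction with
  | grade0 r =>
    refine ⟨?_, ?_, ?_⟩ <;>
      simp [Algebra.algebraMap_eq_smul_one, Algebra.TensorProduct.one_def,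
        TensorProduct.smul_tmul']
  | grade1 h => simp [nablaMatrix]
  | mul P Q hP hQ =>
    simp [Matrix.mul_apply, Fin.sum_univ_two, hP, hQ]
  | add P Q hP hQ =>
    simp [hP, hQ, TensorProduct.add_tmul, TensorProduct.tmul_add]

/-- The Leibniz rule `∇ₜ(PQ) = P·∇ₜQ + ∇ₜP·Q`. -/
theorem nablaAt_mul (t : ℝ) (P Q : NCPoly) :
    nablaAt t (P * Q) = (P ⊗ₜ 1) * nablaAt t Q + nablaAt t P * (1 ⊗ₜ Q) := by
  simp [nablaAt, Matrix.mul_apply, Fin.sum_univ_two, nablaMatrix_diag]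

/-- The iterated derivative
`∇ⁿ_{t₁,…,tₙ} = (id^{⊗(n-1)} ⊗ ∇_{tₙ}) ∘ ⋯ ∘ (id ⊗ ∇_{t₂}) ∘ ∇_{t₁}`, evaluated at the semicircular
variables; here `∇ⁿ⁺¹_{t₁,…,tₙ₊₁} = (id ⊗ ∇ⁿ_{t₂,…,tₙ₊₁}) ∘ ∇_{t₁}`. -/
def iterNabla : (n : ℕ) → (Fin n → ℝ) → NCPoly →ₗ[ℂ] L2Tensor n
  | 0, _ => polyToL2
  | n + 1, t =>
    tensorCons n ∘ₗ TensorProduct.map polyToL2 (iterNabla n (Fin.tail t)) ∘ₗ nablaAt (t 0)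

theorem nablaAt_mem_span (P : NCPoly) :
    (fun t => nablaAt t P) ∈ Submodule.span ℂ
      {φ : ℝ → NCPoly ⊗[ℂ] NCPoly | ∃ (h : RealL2) (a b : NCPoly),
        φ = fun t => ((h t : ℝ) : ℂ) • (a ⊗ₜ b)} := by
  induction P using FreeAlgebra.induction with
  | grade0 r =>
    have h0 : (fun t => nablaAt t (algebraMap ℂ NCPoly r)) = 0 := by
      funext t
      simp [nablaAt, Matrix.algebraMap_matrix_apply]
    rw [h0]
    exact Submodule.zero_mem _
  | grade1 h =>
    exact Submodule.subset_span ⟨h, 1, 1, funext fun t => nablaAt_ι t h⟩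
  | mul P Q hP hQ =>
    simp only [nablaAt_mul]
    refine Submodule.add_mem _ (x := fun t => (P ⊗ₜ[ℂ] (1 : NCPoly)) * nablaAt t Q)
      (y := fun t => nablaAt t P * ((1 : NCPoly) ⊗ₜ[ℂ] Q)) ?_ ?_
    · refine Submodule.span_le.2 ?_ (Submodule.apply_mem_span_image_of_mem_span
        (LinearMap.compLeft (LinearMap.mulLeft ℂ (P ⊗ₜ[ℂ] (1 : NCPoly))) ℝ) hQ)
      rintro _ ⟨_, ⟨h, a, b, rfl⟩, rfl⟩
      refine Submodule.subset_span ⟨h, P * a, b, ?_⟩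
      funext t
      simp
    · refine Submodule.span_le.2 ?_ (Submodule.apply_mem_span_image_of_mem_span
        (LinearMap.compLeft (LinearMap.mulRight ℂ ((1 : NCPoly) ⊗ₜ[ℂ] Q)) ℝ) hP)
      rintro _ ⟨_, ⟨h, a, b, rfl⟩, rfl⟩
      refine Submodule.subset_span ⟨h, a, b * Q, ?_⟩
      funext t
      simp
  | add P Q hP hQ =>
    simp only [map_add]
    exact Submodule.add_mem _ hP hQ

theorem memLp_iterNabla (n : ℕ) (P : NCPoly) :
    MemLp (fun t => iterNabla n t P) 2 (orthant n) := by
  induction n generalizing P with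
  | zero =>
    have : IsFiniteMeasure (orthant 0) := by unfold orthant; infer_instance
    exact memLp_const (polyToL2 P)
  | succ n ih =>
    have key : ∀ φ ∈ Submodule.span ℂ
        {φ : ℝ → NCPoly ⊗[ℂ] NCPoly | ∃ (h : RealL2) (a b : NCPoly),
          φ = fun t => ((h t : ℝ) : ℂ) • (a ⊗ₜ b)},
        MemLp (fun t : Fin (n + 1) → ℝ => tensorCons n
          (TensorProduct.map polyToL2 (iterNabla n (Fin.tail t)) (φ (t 0)))) 2
          (orthant (n + 1)) := by
      intro φ hφ
      induction hφ using Submodule.span_induction with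
      | mem φ hφ =>
        obtain ⟨h, a, b, rfl⟩ := hφ
        have h1 : MemLp (fun s => ((h s : ℝ) : ℂ)) 2 halfLine := (Lp.memLp h).ofReal
        let L : L2Tensor n →L[ℂ] L2Tensor (n + 1) :=
          (UniformSpace.Completion.toComplL (𝕜 := ℂ) (E := L2SC ⊗[ℂ] L2Tensor n)).comp
            (TensorProduct.mkL ℂ L2SC (L2Tensor n) (polyToL2 a))
        have h2 : MemLp (fun t => L (iterNabla n t b)) 2 (orthant n) := L.comp_memLp' (ih b)
        convert memLp_consMul h1 h2 using 2 with t
        rw [map_smul, map_smul, TensorProduct.map_tmul]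
        rfl
      | zero => simp
      | add φ ψ _ _ hφ hψ =>
        simp only [Pi.add_apply, map_add]
        exact hφ.add hψ
      | smul c φ _ hφ =>
        simp only [Pi.smul_apply, map_smul]
        exact hφ.const_smul c
    exact key _ (nablaAt_mem_span P)

/-- `∇ⁿP(S)` as an element of `𝕄₂^{n,n+1}`. -/
def nablaPow (n : ℕ) (P : NCPoly) : RandomField n := (memLp_iterNabla n P).toLp _

/-- The symmetrized derivative `Dⁿ = n! ∇ⁿ`. -/
def symNablaPow (n : ℕ) (P : NCPoly) : RandomField n := (n.factorial : ℂ) • nablaPow n P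

/-! ### The symmetrized Sobolev-Wigner spaces -/

/-- `IsSymDerivative p F U` says that `(F, U)` belongs to the closure of the graph of
`Dᵖ : SC_alg → 𝕄₂^{p,p+1}` in `L²(SC) × 𝕄₂^{p,p+1}`, i.e. `DᵖF = U` for the closed operator. -/
def IsSymDerivative (p : ℕ) (F : L2SC) (U : RandomField p) : Prop :=
  (F, U) ∈ closure {z : L2SC × RandomField p | ∃ P : NCPoly, z = (polyToL2 P, symNablaPow p P)}

/-- The space `𝔻^{p,2,σ}`: the elements of `L²(SC)` that are limits of sequences of `SC_alg` which
are Cauchy for the norm `(‖F‖² + ∑_{j=1}^p ‖DʲF‖²)^{1/2}`. -/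
def SobolevWigner (p : ℕ) : Set L2SC :=
  {F | ∃ P : ℕ → NCPoly, Tendsto (fun m => polyToL2 (P m)) atTop (𝓝 F) ∧
    ∀ j ∈ Finset.Icc 1 p, CauchySeq fun m => symNablaPow j (P m)}

end Wigner

end

namespace Wigner

/-! ### Inner products of elementary tensors -/

/-! The map `X ↦ XΩ` is isometric from `L²(SC)` to the Fock space and sends `Iₙ(f)` to `f` in degree
`n`, so everything reduces to computing `‖DᵖP‖` in terms of the components of `P(S)Ω`.

Wick polynomials, with `W(S)Ω = h₁ ⊗ ⋯ ⊗ hₙ`, span all polynomials. Differentiating one removes a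
letter and leaves the Wick polynomials of the two halves as tensor legs (`nablaAt_wick`). Since each
further derivative acts on the last leg, `∇ᵏ` amounts to choosing `k` of the `n` letters, and only
identical choices pair nontrivially. Hence `⟨∇ᵏW, ∇ᵏW'⟩` is `n.choose k` times the inner product of
the words (`inner_nablaPow_wick`). Multiplying by `(k!)²` turns this into the weight `k!
n(n-1)⋯(n-k+1)` on the `n`-th component (`hasSum_norm_symNablaPow`).

Thus the graph of `Dᵖ` is metrically that of a diagonal operator on the Fock space. Coordinatewise
limits give closability, the norm formula and necessity (`hasSum_norm_of_tendsto`,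
`IsSymDerivative.unique`). For sufficiency, off-diagonal boxes come from polynomials living in a
single chaos. There all the weights are constants, so closures and sums over `n` give approximation
in all the norms at once (`chaosMap_mem_of_isWignerIntegral`). -/

theorem integral_inner_consMul {E : Type*} [NormedAddCommGroup E] [InnerProductSpace ℂ E] {n : ℕ}
    (h h' : ℝ → ℂ) (g g' : (Fin n → ℝ) → E) :
    ∫ t, inner ℂ (consMul h g t) (consMul h' g' t) ∂orthant (n + 1)
      = (∫ s, inner ℂ (h s) (h' s) ∂halfLine) * ∫ t, inner ℂ (g t) (g' t) ∂orthant n := by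
  rw [← integral_prod_mul]
  have key := (measurePreserving_piFinSuccAbove (fun _ : Fin (n + 1) => halfLine) 0).integral_comp'
    (fun z : ℝ × (Fin n → ℝ) => inner ℂ (h z.1) (h' z.1) * inner ℂ (g z.2) (g' z.2))
  refine Eq.trans ?_ key
  refine integral_congr_ae (ae_of_all _ fun t => ?_)
  simp only [consMul, inner_smul_left, inner_smul_right, RCLike.inner_apply]
  change _ = h' (t 0) * (starRingEnd ℂ) (h (t 0)) * inner ℂ (g (Fin.tail t)) (g' (Fin.tail t))
  ring

theorem consMul_congr_left {E : Type*} [NormedAddCommGroup E] [NormedSpace ℂ E] {n : ℕ}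
    {h h' : ℝ → ℂ} (g : (Fin n → ℝ) → E) (hh : h =ᵐ[halfLine] h') :
    consMul h g =ᵐ[orthant (n + 1)] consMul h' g := by
  have hq : Measure.QuasiMeasurePreserving (fun t : Fin (n + 1) → ℝ => t 0)
      (orthant (n + 1)) halfLine :=
    Measure.quasiMeasurePreserving_fst.comp (measurePreserving_split n).quasiMeasurePreserving
  filter_upwards [hq.ae_eq_comp hh] with t ht
  simp only [Function.comp] at ht
  simp only [consMul, ht]

theorem inner_consTensor {n : ℕ} (h h' : Lp ℂ 2 halfLine) (f f' : ChaosL2 n) :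
    inner ℂ (consTensor h f) (consTensor h' f') = inner ℂ h h' * inner ℂ f f' := by
  simp only [L2.inner_def]
  rw [← integral_inner_consMul]
  refine integral_congr_ae ?_
  filter_upwards [MemLp.coeFn_toLp (memLp_consMul (Lp.memLp h) (Lp.memLp f)),
    MemLp.coeFn_toLp (memLp_consMul (Lp.memLp h') (Lp.memLp f'))] with t h1 h2
  rw [consTensor, consTensor, h1, h2]

theorem consTensor_sub_left {n : ℕ} (h h' : Lp ℂ 2 halfLine) (f : ChaosL2 n) :
    consTensor (h - h') f = consTensor h f - consTensor h' f := by
  unfold consTensor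
  rw [← MemLp.toLp_sub]
  refine MemLp.toLp_congr _ _ ((consMul_congr_left f (Lp.coeFn_sub h h')).trans ?_)
  filter_upwards with t
  simp [consMul, sub_mul]

/-! ### Creation and annihilation operators -/

@[simp] theorem creation_apply_zero (h : Lp ℂ 2 halfLine) (ψ : Fock) : creation h ψ 0 = 0 := rfl

@[simp] theorem creation_apply_succ (h : Lp ℂ 2 halfLine) (ψ : Fock) (n : ℕ) :
    creation h ψ (n + 1) = consTensor h (ψ n) := rfl

theorem consTensor_zero_right {n : ℕ} (h : Lp ℂ 2 halfLine) :
    consTensor h (0 : ChaosL2 n) = 0 := by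
  simpa using consTensor_smul h 0 (0 : ChaosL2 n)

theorem creation_single (h : Lp ℂ 2 halfLine) (n : ℕ) (f : ChaosL2 n) :
    creation h (lp.single 2 n f) = lp.single 2 (n + 1) (consTensor h f) := by
  ext1
  funext m
  cases m with
  | zero =>
    rw [creation_apply_zero, lp.single_apply_ne _ _ _ (by omega)]
  | succ m =>
    rw [creation_apply_succ]
    by_cases hm : m = n
    · subst hm
      rw [lp.single_apply_self, lp.single_apply_self]
    · rw [lp.single_apply_ne _ _ _ hm, lp.single_apply_ne _ _ _ (by omega), consTensor_zero_right]

theorem inner_creation_creation (h g : Lp ℂ 2 halfLine) (φ ψ : Fock) :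
    inner ℂ (creation h φ) (creation g ψ) = inner ℂ h g * inner ℂ φ ψ := by
  have h1 := lp.hasSum_inner (𝕜 := ℂ) (creation h φ) (creation g ψ)
  rw [← hasSum_nat_add_iff' 1] at h1
  simp only [Finset.sum_range_one, creation_apply_zero, inner_zero_left, sub_zero,
    creation_apply_succ, inner_consTensor] at h1
  exact h1.unique ((lp.hasSum_inner (𝕜 := ℂ) φ ψ).mul_left _)

/-- The free commutation relation `l(h)* l(g) = ⟨h, g⟩`. Together with `l(h)*Ω = 0` it is all that
is ever needed about the annihilation operators. -/
theorem adjoint_creation_creation (h g : Lp ℂ 2 halfLine) (φ : Fock) :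
    ContinuousLinearMap.adjoint (creation h) (creation g φ) = inner ℂ h g • φ := by
  refine ext_inner_left ℂ fun ψ => ?_
  rw [ContinuousLinearMap.adjoint_inner_right, inner_creation_creation, inner_smul_right]

theorem adjoint_creation_single_zero (h : Lp ℂ 2 halfLine) (c : ChaosL2 0) :
    ContinuousLinearMap.adjoint (creation h) (lp.single 2 0 c) = 0 := by
  refine ext_inner_right ℂ fun ψ => ?_
  rw [ContinuousLinearMap.adjoint_inner_left, lp.inner_single_left, creation_apply_zero,
    inner_zero_right, inner_zero_left]

theorem creation_sub_left (h h' : Lp ℂ 2 halfLine) :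
    creation (h - h') = creation h - creation h' := by
  ext1 ψ
  ext1
  funext n
  cases n with
  | zero => exact (sub_zero (0 : ChaosL2 0)).symm
  | succ n => exact consTensor_sub_left h h' (ψ n)

theorem complexify_sub (h h' : RealL2) : complexify (h - h') = complexify h - complexify h' :=
  map_sub (ContinuousLinearMap.compLpₗ 2 halfLine Complex.ofRealCLM) h h'

theorem field_sub (h h' : RealL2) : field (h - h') = field h - field h' := by
  simp only [field, complexify_sub, creation_sub_left, map_sub]
  abel

theorem field_vacuum (h : RealL2) : field h vacuum = creation (complexify h) vacuum := by
  rw [field, add_apply]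
  conv_rhs => rw [← add_zero (creation (complexify h) vacuum)]
  congr 1
  exact adjoint_creation_single_zero _ _

theorem field_creation (h g : RealL2) (φ : Fock) :
    field h (creation (complexify g) φ) =
      creation (complexify h) (creation (complexify g) φ)
        + inner ℂ (complexify h) (complexify g) • φ := by
  rw [field, add_apply, adjoint_creation_creation]

/-! ### Words in the Fock space and Wick polynomials -/

/-- The elementary tensor `h₁ ⊗ ⋯ ⊗ hₙ` in the Fock space. -/
noncomputable def wordVec : List RealL2 → Fock
  | [] => vacuum
  | h :: L => creation (complexify h) (wordVec L)

/-- The inner product `∏ ⟨hᵢ, gᵢ⟩` of two elementary tensors. -/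
noncomputable def wordInner : List RealL2 → List RealL2 → ℂ
  | [], [] => 1
  | h :: L, g :: M => inner ℂ (complexify h) (complexify g) * wordInner L M
  | [], _ :: _ => 0
  | _ :: _, [] => 0

theorem inner_vacuum_vacuum : inner ℂ (vacuum 0) (vacuum 0) = (1 : ℂ) := by
  rw [vacuum, lp.single_apply_self, inner_self_eq_norm_sq_to_K,
    norm_indicatorConstLp (by norm_num) (by norm_num)]
  simp [orthant, Measure.real]

/-- Kept degree by degree, because the norms of the derivatives weight each degree differently. -/
theorem inner_wordVec (L M : List RealL2) (n : ℕ) :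
    inner ℂ (wordVec L n) (wordVec M n) = if n = L.length then wordInner L M else 0 := by
  have hv : ∀ n : ℕ, n ≠ 0 → vacuum n = 0 := fun n hn => lp.single_apply_ne _ _ _ hn
  induction L generalizing M n with
  | nil =>
    cases M with
    | nil =>
      by_cases hn : n = 0
      · subst hn
        simpa [wordVec, wordInner] using inner_vacuum_vacuum
      · simp [wordVec, hn, hv]
    | cons g M =>
      cases n with
      | zero => simp [wordVec, wordInner]
      | succ n => simp [wordVec, hv]
  | cons h L ih =>
    cases M with
    | nil =>
      cases n with
      | zero => simp [wordVec]
      | succ n => simp [wordVec, hv, wordInner]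
    | cons g M =>
      cases n with
      | zero => simp [wordVec]
      | succ n => simp [wordVec, inner_consTensor, ih, wordInner]

/-- The Wick polynomial with `W(S) Ω = h₁ ⊗ ⋯ ⊗ hₙ`. -/
noncomputable def wick : List RealL2 → NCPoly
  | [] => 1
  | [h] => FreeAlgebra.ι ℂ h
  | h :: g :: L => FreeAlgebra.ι ℂ h * wick (g :: L)
      - (inner ℂ (complexify h) (complexify g) : ℂ) • wick L

/-- The vector `P(S) Ω`. -/
noncomputable def polyVec : NCPoly →ₗ[ℂ] Fock where
  toFun P := (evalPoly P : FockOp) vacuum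
  map_add' P Q := by simp
  map_smul' c P := by simp

theorem polyVec_apply (P : NCPoly) : polyVec P = (evalPoly P : FockOp) vacuum := rfl

theorem polyVec_one : polyVec 1 = vacuum := by
  rw [polyVec_apply, map_one]
  rfl

theorem polyVec_ι_mul (h : RealL2) (P : NCPoly) :
    polyVec (FreeAlgebra.ι ℂ h * P) = field h (polyVec P) := by
  rw [polyVec_apply, polyVec_apply, map_mul, evalPoly, FreeAlgebra.lift_ι_apply]
  rfl

theorem polyVec_wick : ∀ L : List RealL2, polyVec (wick L) = wordVec L
  | [] => polyVec_one
  | [h] => by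
    have := polyVec_ι_mul h 1
    rw [mul_one, polyVec_one, field_vacuum] at this
    exact this
  | h :: g :: L => by
    rw [wick, map_sub, map_smul, polyVec_ι_mul, polyVec_wick (g :: L), polyVec_wick L]
    simp only [wordVec]
    rw [field_creation, add_sub_cancel_right]

/-- The recursion reads `X_h · wick (g :: L) = wick (h :: g :: L) + ⟨h, g⟩ wick L`, so the span is
stable under left multiplication by the generators; it contains `1`. The identity is formal, in the
free algebra. -/
theorem span_range_wick : Submodule.span ℂ (Set.range wick) = ⊤ := by
  have key : ∀ P Q : NCPoly, Q ∈ Submodule.span ℂ (Set.range wick) →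
      P * Q ∈ Submodule.span ℂ (Set.range wick) := by
    intro P
    induction P using FreeAlgebra.induction with
    | grade0 r =>
      intro Q hQ
      rw [← Algebra.smul_def]
      exact Submodule.smul_mem _ r hQ
    | grade1 h =>
      intro Q hQ
      induction hQ using Submodule.span_induction with
      | mem Q hQ =>
        obtain ⟨L, rfl⟩ := hQ
        cases L with
        | nil =>
          refine Submodule.subset_span ⟨[h], ?_⟩
          simp [wick]
        | cons g L =>
          have h1 : FreeAlgebra.ι ℂ h * wick (g :: L) = wick (h :: g :: L)
              + (inner ℂ (complexify h) (complexify g) : ℂ) • wick L := by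
            rw [wick, sub_add_cancel]
          rw [h1]
          exact Submodule.add_mem _ (Submodule.subset_span ⟨_, rfl⟩)
            (Submodule.smul_mem _ _ (Submodule.subset_span ⟨_, rfl⟩))
      | zero => simp
      | add x y _ _ hx hy =>
        rw [mul_add]
        exact Submodule.add_mem _ hx hy
      | smul c x _ hx =>
        rw [mul_smul_comm]
        exact Submodule.smul_mem _ _ hx
    | mul P P' hP hP' =>
      intro Q hQ
      rw [mul_assoc]
      exact hP _ (hP' _ hQ)
    | add P P' hP hP' =>
      intro Q hQ
      rw [add_mul]
      exact Submodule.add_mem _ (hP _ hQ) (hP' _ hQ)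
  refine Submodule.eq_top_iff'.2 fun P => ?_
  rw [← mul_one P]
  exact key P 1 (Submodule.subset_span ⟨[], rfl⟩)

/-! ### The derivative of a Wick polynomial -/

/-- All ways to write a word as `a ++ x :: b`. -/
def cuts {α : Type*} : List α → List (List α × α × List α)
  | [] => []
  | h :: L => ([], h, L) :: (cuts L).map fun c => (h :: c.1, c.2.1, c.2.2)

theorem nablaAt_one (t : ℝ) : nablaAt t 1 = 0 := by
  simp [nablaAt]

/-- Apply Leibniz to the recursion. A cut of `g :: L` with left part `g :: a` becomes, after left
multiplication by `X_h`, the cut with left part `h :: g :: a` plus `⟨h, g⟩` times the cut of `L`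
with left part `a`. These extra terms sum to `⟨h, g⟩ ∇ₜ(wick L)`, which the correction term of the
recursion cancels. -/
theorem nablaAt_wick (t : ℝ) : ∀ L : List RealL2, nablaAt t (wick L) =
    ((cuts L).map fun c => ((c.2.1 t : ℝ) : ℂ) • (wick c.1 ⊗ₜ[ℂ] wick c.2.2)).sum
  | [] => nablaAt_one t
  | [h] => by simp [wick, nablaAt_ι, cuts]
  | h :: g :: L => by
    have h1 : ∀ c : List RealL2 × RealL2 × List RealL2,
        (FreeAlgebra.ι ℂ h ⊗ₜ[ℂ] (1 : NCPoly)) *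
            (((c.2.1 t : ℝ) : ℂ) • (wick (g :: c.1) ⊗ₜ[ℂ] wick c.2.2)) =
          ((c.2.1 t : ℝ) : ℂ) • (wick (h :: g :: c.1) ⊗ₜ[ℂ] wick c.2.2)
          + (inner ℂ (complexify h) (complexify g) : ℂ) •
            (((c.2.1 t : ℝ) : ℂ) • (wick c.1 ⊗ₜ[ℂ] wick c.2.2)) := by
      intro c
      rw [mul_smul_comm, Algebra.TensorProduct.tmul_mul_tmul, one_mul, wick,
        TensorProduct.sub_tmul, ← TensorProduct.smul_tmul', smul_sub,
        smul_comm (inner ℂ (complexify h) (complexify g) : ℂ), sub_add_cancel]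
    rw [wick, map_sub, map_smul, nablaAt_mul, nablaAt_ι, nablaAt_wick t (g :: L),
      nablaAt_wick t L]
    simp only [cuts, List.map_cons, List.map_map, List.sum_cons, Function.comp_def, mul_add,
      ← List.sum_map_mul_left, h1, List.sum_map_add, List.smul_sum, wick]
    rw [mul_smul_comm, smul_mul_assoc, Algebra.TensorProduct.tmul_mul_tmul,
      Algebra.TensorProduct.tmul_mul_tmul]
    simp only [one_mul, mul_one]
    abel


/-! ### Inner products of iterated derivatives -/

theorem inner_polyToL2 (P Q : NCPoly) :
    inner ℂ (polyToL2 P) (polyToL2 Q) = inner ℂ (polyVec P) (polyVec Q) := by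
  have h1 : inner ℂ (polyToL2 P) (polyToL2 Q)
      = inner ℂ (show PreL2 from evalPoly P) (show PreL2 from evalPoly Q) :=
    UniformSpace.Completion.inner_coe (𝕜 := ℂ) (E := PreL2) _ _
  rw [h1]
  exact vacuumState_star_mul (evalPoly P) (evalPoly Q)

theorem inner_wordVec_wordVec (L M : List RealL2) :
    inner ℂ (wordVec L) (wordVec M) = wordInner L M := by
  have h1 := lp.hasSum_inner (𝕜 := ℂ) (wordVec L) (wordVec M)
  simp only [inner_wordVec] at h1
  exact h1.unique (hasSum_ite_eq _ _)

theorem inner_complexify (h g : RealL2) :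
    ∫ s, inner ℂ ((h s : ℝ) : ℂ) ((g s : ℝ) : ℂ) ∂halfLine
      = inner ℂ (complexify h) (complexify g) := by
  rw [L2.inner_def]
  refine integral_congr_ae ?_
  filter_upwards [Complex.ofRealCLM.coeFn_compLp h, Complex.ofRealCLM.coeFn_compLp g] with s h1 h2
  rw [complexify, complexify, h1, h2]
  rfl

theorem inner_tensorCons_tmul (k : ℕ) (x x' : L2SC) (y y' : L2Tensor k) :
    inner ℂ (tensorCons k (x ⊗ₜ y)) (tensorCons k (x' ⊗ₜ y')) = inner ℂ x x' * inner ℂ y y' := by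
  rw [← TensorProduct.inner_tmul]
  exact UniformSpace.Completion.inner_coe (𝕜 := ℂ) (E := L2SC ⊗[ℂ] L2Tensor k) _ _

/-- The function `t ↦ h(t₀) a ⊗ ∇ᵏ_{t₁,…,tₖ} b` on `ℝ₊ᵏ⁺¹`. -/
noncomputable def cutFun (k : ℕ) (a : NCPoly) (h : RealL2) (b : NCPoly) :
    (Fin (k + 1) → ℝ) → L2Tensor (k + 1) :=
  consMul (fun s => ((h s : ℝ) : ℂ)) fun t => tensorCons k (polyToL2 a ⊗ₜ iterNabla k t b)

theorem memLp_cutFun (k : ℕ) (a : NCPoly) (h : RealL2) (b : NCPoly) :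
    MemLp (cutFun k a h b) 2 (orthant (k + 1)) := by
  have h1 : MemLp (fun s => ((h s : ℝ) : ℂ)) 2 halfLine := (Lp.memLp h).ofReal
  let T : L2Tensor k →L[ℂ] L2Tensor (k + 1) :=
    (UniformSpace.Completion.toComplL (𝕜 := ℂ) (E := L2SC ⊗[ℂ] L2Tensor k)).comp
      (TensorProduct.mkL ℂ L2SC (L2Tensor k) (polyToL2 a))
  have h2 : MemLp (fun t => T (iterNabla k t b)) 2 (orthant k) :=
    T.comp_memLp' (memLp_iterNabla k b)
  exact memLp_consMul h1 h2

/-- The class of `cutFun` in `𝕄₂^{k+1,k+2}`. -/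
noncomputable def cutField (k : ℕ) (a : NCPoly) (h : RealL2) (b : NCPoly) : RandomField (k + 1) :=
  (memLp_cutFun k a h b).toLp _

theorem inner_nablaPow (k : ℕ) (P Q : NCPoly) :
    inner ℂ (nablaPow k P) (nablaPow k Q)
      = ∫ t, inner ℂ (iterNabla k t P) (iterNabla k t Q) ∂orthant k := by
  rw [L2.inner_def]
  refine integral_congr_ae ?_
  filter_upwards [(memLp_iterNabla k P).coeFn_toLp, (memLp_iterNabla k Q).coeFn_toLp] with t h1 h2
  rw [nablaPow, nablaPow, h1, h2]

/-- Fubini separates the first time variable, and the tensor inner product separates the left leg.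
The remaining factor is a derivative of order `k`, which sets up the induction on the order. -/
theorem inner_cutField (k : ℕ) (a b c d : NCPoly) (h g : RealL2) :
    inner ℂ (cutField k a h b) (cutField k c g d)
      = inner ℂ (complexify h) (complexify g) *
        (inner ℂ (polyVec a) (polyVec c) * inner ℂ (nablaPow k b) (nablaPow k d)) := by
  rw [L2.inner_def, ← inner_complexify, inner_nablaPow, ← integral_const_mul]
  have h1 : ∀ t, inner ℂ (polyVec a) (polyVec c) * inner ℂ (iterNabla k t b) (iterNabla k t d)
      = inner ℂ (tensorCons k (polyToL2 a ⊗ₜ iterNabla k t b))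
        (tensorCons k (polyToL2 c ⊗ₜ iterNabla k t d)) := fun t => by
    rw [inner_tensorCons_tmul, inner_polyToL2]
  simp only [h1]
  rw [← integral_inner_consMul]
  refine integral_congr_ae ?_
  filter_upwards [(memLp_cutFun k a h b).coeFn_toLp, (memLp_cutFun k c g d).coeFn_toLp]
    with t h1 h2
  rw [cutField, cutField, h1, h2]
  rfl

theorem nablaPow_succ_wick (k : ℕ) (L : List RealL2) :
    nablaPow (k + 1) (wick L)
      = ((cuts L).map fun c => cutField k (wick c.1) c.2.1 (wick c.2.2)).sum := by
  have key : ∀ l : List (List RealL2 × RealL2 × List RealL2),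
      ((l.map fun c => cutField k (wick c.1) c.2.1 (wick c.2.2)).sum : RandomField (k + 1))
        =ᵐ[orthant (k + 1)]
      fun t => (l.map fun c => cutFun k (wick c.1) c.2.1 (wick c.2.2) t).sum := by
    intro l
    induction l with
    | nil => exact Lp.coeFn_zero _ _ _
    | cons c l ih =>
      simp only [List.map_cons, List.sum_cons]
      filter_upwards [Lp.coeFn_add (cutField k (wick c.1) c.2.1 (wick c.2.2))
        (l.map fun c => cutField k (wick c.1) c.2.1 (wick c.2.2)).sum,
        (memLp_cutFun k (wick c.1) c.2.1 (wick c.2.2)).coeFn_toLp, ih] with t h1 h2 h3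
      rw [h1, Pi.add_apply, h3, cutField, h2]
  refine Lp.ext ?_
  filter_upwards [(memLp_iterNabla (k + 1) (wick L)).coeFn_toLp, key (cuts L)] with t h1 h2
  rw [h2, nablaPow, h1]
  simp only [iterNabla, LinearMap.comp_apply, nablaAt_wick, map_list_sum, List.map_map]
  congr 2
  funext c
  simp only [Function.comp_apply, map_smul, TensorProduct.map_tmul]
  rfl

theorem inner_list_sum {E α β : Type*} [NormedAddCommGroup E] [InnerProductSpace ℂ E]
    (l : List α) (m : List β) (u : α → E) (v : β → E) :
    inner ℂ (l.map u).sum (m.map v).sum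
      = (l.map fun a => (m.map fun b => inner ℂ (u a) (v b)).sum).sum := by
  have h1 : ∀ x : E, inner ℂ x (m.map v).sum = (m.map fun b => inner ℂ x (v b)).sum := by
    intro x
    induction m with
    | nil => simp
    | cons b m ih => simp only [List.map_cons, List.sum_cons, inner_add_right, ih]
  induction l with
  | nil => simp
  | cons a l ih => rw [List.map_cons, List.sum_cons, inner_add_left, ih, h1]; rfl

/-- Cuts at different positions are orthogonal: an empty left part pairs to zero with a nonempty
one. Cuts at the same position reassemble `wordInner L M`, weighted by the ways to choose `k`
letters to the right of the cut. The total is the hockey-stick identity, obtained by Pascal's rule.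
-/
theorem sum_cuts_wordInner (k : ℕ) (L M : List RealL2) :
    ((cuts L).map fun c => ((cuts M).map fun d =>
      inner ℂ (complexify c.2.1) (complexify d.2.1) *
        (wordInner c.1 d.1 * (((c.2.2.length.choose k : ℕ) : ℂ) * wordInner c.2.2 d.2.2))).sum).sum
      = ((L.length.choose (k + 1) : ℕ) : ℂ) * wordInner L M := by
  induction L generalizing M with
  | nil => simp [cuts]
  | cons h L ih =>
    cases M with
    | nil => simp [cuts, wordInner, Function.comp_def]
    | cons g M =>
      have h1 : ∀ c d : List RealL2 × RealL2 × List RealL2,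
          inner ℂ (complexify c.2.1) (complexify d.2.1) *
            (inner ℂ (complexify h) (complexify g) * wordInner c.1 d.1 *
              (((c.2.2.length.choose k : ℕ) : ℂ) * wordInner c.2.2 d.2.2))
          = inner ℂ (complexify h) (complexify g) *
            (inner ℂ (complexify c.2.1) (complexify d.2.1) *
        (wordInner c.1 d.1 * (((c.2.2.length.choose k : ℕ) : ℂ) * wordInner c.2.2 d.2.2))) := by
        intro c d
        ring
      simp only [cuts, List.map_cons, List.map_map, List.sum_cons, Function.comp_def, wordInner,
        zero_mul, mul_zero, List.map_const', List.sum_replicate, smul_zero, add_zero, zero_add, h1,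
        List.sum_map_mul_left, ih, List.length_cons, Nat.choose_succ_succ, Nat.cast_add]
      ring

theorem inner_nablaPow_wick (k : ℕ) (L M : List RealL2) :
    inner ℂ (nablaPow k (wick L)) (nablaPow k (wick M))
      = ((L.length.choose k : ℕ) : ℂ) * wordInner L M := by
  induction k generalizing L M with
  | zero =>
    rw [inner_nablaPow]
    have h1 : ∀ t, inner ℂ (iterNabla 0 t (wick L)) (iterNabla 0 t (wick M)) = wordInner L M :=
      fun t => by
        rw [← inner_wordVec_wordVec, ← polyVec_wick, ← polyVec_wick]
        exact inner_polyToL2 _ _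
    simp only [h1]
    -- `ℝ₊⁰` is a single point of mass `1`.
    simp [orthant, Measure.real]
  | succ k ih =>
    simp only [nablaPow_succ_wick, inner_list_sum, inner_cutField, ih, polyVec_wick,
      inner_wordVec_wordVec]
    exact sum_cuts_wordInner k L M

/-! ### The norm identity for arbitrary polynomials -/

/-- `P ↦ ∇ⁿP(S)` as a linear map. -/
noncomputable def nablaPowₗ (k : ℕ) : NCPoly →ₗ[ℂ] RandomField k where
  toFun := nablaPow k
  map_add' P Q := by
    unfold nablaPow
    rw [← MemLp.toLp_add]
    exact MemLp.toLp_congr _ _ (ae_of_all _ fun t => by simp)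
  map_smul' c P := by
    unfold nablaPow
    rw [RingHom.id_apply, ← MemLp.toLp_const_smul]
    exact MemLp.toLp_congr _ _ (ae_of_all _ fun t => by simp)

/-- Both sides are sesquilinear in `(P, Q)`, so Wick polynomials suffice. The right-hand data depend
on `P` and `Q` only through `P(S)Ω` and `Q(S)Ω`, so relations among the `S(h)` do no harm. -/
theorem hasSum_inner_nablaPow (k : ℕ) (P Q : NCPoly) :
    HasSum (fun n => ((n.choose k : ℕ) : ℂ) * inner ℂ (polyVec P n) (polyVec Q n))
      (inner ℂ (nablaPowₗ k P) (nablaPowₗ k Q)) := by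
  have hP : P ∈ Submodule.span ℂ (Set.range wick) := by rw [span_range_wick]; trivial
  have hQ : Q ∈ Submodule.span ℂ (Set.range wick) := by rw [span_range_wick]; trivial
  induction hP using Submodule.span_induction with
  | mem P hP =>
    obtain ⟨L, rfl⟩ := hP
    induction hQ using Submodule.span_induction with
    | mem Q hQ =>
      obtain ⟨M, rfl⟩ := hQ
      have h1 : inner ℂ (nablaPowₗ k (wick L)) (nablaPowₗ k (wick M)) = _ :=
        inner_nablaPow_wick k L M
      rw [h1]
      convert hasSum_ite_eq L.length _ using 2 with n
      rw [polyVec_wick, polyVec_wick, inner_wordVec]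
      split_ifs with hn
      · rw [hn]
      · rw [mul_zero]
    | zero => simp [hasSum_zero]
    | add Q Q' _ _ h h' =>
      simpa only [map_add, lp.coeFn_add, Pi.add_apply, inner_add_right, mul_add] using h.add h'
    | smul c Q _ h =>
      simpa only [map_smul, lp.coeFn_smul, Pi.smul_apply, inner_smul_right, mul_left_comm]
        using h.mul_left c
  | zero => simp [hasSum_zero]
  | add P P' _ _ h h' =>
    simpa only [map_add, lp.coeFn_add, Pi.add_apply, inner_add_left, mul_add] using h.add h'
  | smul c P _ h =>
    simpa only [map_smul, lp.coeFn_smul, Pi.smul_apply, inner_smul_left, mul_left_comm]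
      using h.mul_left (starRingEnd ℂ c)

theorem hasSum_norm_nablaPow (k : ℕ) (P : NCPoly) :
    HasSum (fun n => (n.choose k : ℝ) * ‖polyVec P n‖ ^ 2) (‖nablaPowₗ k P‖ ^ 2) := by
  rw [← Complex.hasSum_ofReal]
  have h1 := hasSum_inner_nablaPow k P P
  simp only [inner_self_eq_norm_sq_to_K] at h1
  push_cast
  exact h1


/-! ### `L²(SC)` and the Fock space -/

theorem norm_preL2 (x : PreL2) : ‖x‖ = ‖((show SCAlg from x) : FockOp) vacuum‖ := by
  have h1 : inner ℂ x x = inner ℂ (((show SCAlg from x) : FockOp) vacuum)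
      (((show SCAlg from x) : FockOp) vacuum) := vacuumState_star_mul x x
  rw [norm_eq_sqrt_re_inner (𝕜 := ℂ) x, h1, ← norm_eq_sqrt_re_inner (𝕜 := ℂ)]

/-- The map `X ↦ X Ω` on the von Neumann algebra. -/
noncomputable def preL2ToFock : PreL2 →L[ℂ] Fock :=
  LinearMap.mkContinuous
    { toFun := fun x => ((show SCAlg from x) : FockOp) vacuum
      map_add' := fun _ _ => rfl
      map_smul' := fun _ _ => rfl } 1 (fun x => by
        rw [one_mul, norm_preL2]
        rfl)

/-- The continuous extension `L²(SC) → ℱ` of `X ↦ X Ω`. -/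
noncomputable def toFock : L2SC →L[ℂ] Fock :=
  preL2ToFock.extend (UniformSpace.Completion.toComplL (𝕜 := ℂ) (E := PreL2))

theorem toFock_toL2 (x : SCAlg) : toFock (toL2 x) = (x : FockOp) vacuum :=
  ContinuousLinearMap.extend_eq (e := UniformSpace.Completion.toComplL (𝕜 := ℂ) (E := PreL2))
    preL2ToFock UniformSpace.Completion.denseRange_coe
    (UniformSpace.Completion.isUniformInducing_coe PreL2) x

theorem toFock_polyToL2 (P : NCPoly) : toFock (polyToL2 P) = polyVec P := toFock_toL2 _

theorem memℓp_of_summable_sq {φ : (n : ℕ) → ChaosL2 n} (h : Summable fun n => ‖φ n‖ ^ 2) :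
    Memℓp φ 2 :=
  memℓp_gen (by simpa using h)

theorem hasSum_norm_sq (φ : Fock) : HasSum (fun n => ‖φ n‖ ^ 2) (‖φ‖ ^ 2) := by
  simpa using lp.hasSum_norm (p := 2) (by norm_num) φ

/-! ### Weighted Fock vectors -/

/-- The weight `(j! n(n-1)⋯(n-j+1))^{1/2}` of the `n`-th chaos. -/
noncomputable def chaosWeight (j n : ℕ) : ℝ := √((j.factorial : ℝ) * (n.descFactorial j : ℝ))

theorem sq_chaosWeight (j n : ℕ) :
    chaosWeight j n ^ 2 = (j.factorial : ℝ) * (n.descFactorial j : ℝ) :=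
  Real.sq_sqrt (by positivity)

theorem norm_sq_chaosWeight_smul {n : ℕ} (j : ℕ) (f : ChaosL2 n) :
    ‖(chaosWeight j n : ℂ) • f‖ ^ 2 = (j.factorial : ℝ) * ((n.descFactorial j : ℝ) * ‖f‖ ^ 2) := by
  rw [norm_smul, mul_pow, Complex.norm_real, Real.norm_eq_abs, sq_abs, sq_chaosWeight, mul_assoc]

/-- `P ↦ DʲP(S)` as a linear map. -/
noncomputable def symNablaPowₗ (j : ℕ) : NCPoly →ₗ[ℂ] RandomField j :=
  (j.factorial : ℂ) • nablaPowₗ j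

theorem hasSum_norm_symNablaPow (j : ℕ) (P : NCPoly) :
    HasSum (fun n => ‖(chaosWeight j n : ℂ) • polyVec P n‖ ^ 2) (‖symNablaPowₗ j P‖ ^ 2) := by
  have h1 := (hasSum_norm_nablaPow j P).mul_left ((j.factorial : ℝ) ^ 2)
  rw [symNablaPowₗ, LinearMap.smul_apply, norm_smul, mul_pow, Complex.norm_natCast]
  refine (congrArg (HasSum · _) (funext fun n => ?_)).mpr h1
  -- Here `(j!)² (n choose j) = j! · n(n-1)⋯(n-j+1)`.
  rw [norm_sq_chaosWeight_smul, Nat.descFactorial_eq_factorial_mul_choose]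
  push_cast
  ring

/-- The vector `((j! n(n-1)⋯(n-j+1))^{1/2} (P(S) Ω)ₙ)ₙ`. -/
noncomputable def weightedVec (j : ℕ) : NCPoly →ₗ[ℂ] Fock where
  toFun P := ⟨fun n => (chaosWeight j n : ℂ) • polyVec P n,
    memℓp_of_summable_sq (hasSum_norm_symNablaPow j P).summable⟩
  map_add' P Q := by
    ext1
    funext n
    change (chaosWeight j n : ℂ) • polyVec (P + Q) n
      = (chaosWeight j n : ℂ) • polyVec P n + (chaosWeight j n : ℂ) • polyVec Q n
    rw [map_add, lp.coeFn_add, Pi.add_apply, smul_add]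
  map_smul' c P := by
    ext1
    funext n
    change (chaosWeight j n : ℂ) • polyVec (c • P) n = c • (chaosWeight j n : ℂ) • polyVec P n
    rw [map_smul, lp.coeFn_smul, Pi.smul_apply, smul_comm]

theorem weightedVec_apply (j : ℕ) (P : NCPoly) (n : ℕ) :
    weightedVec j P n = (chaosWeight j n : ℂ) • polyVec P n := rfl

theorem norm_weightedVec (j : ℕ) (P : NCPoly) : ‖weightedVec j P‖ = ‖symNablaPowₗ j P‖ := by
  have h1 := (hasSum_norm_sq (weightedVec j P)).unique (hasSum_norm_symNablaPow j P)
  exact (sq_eq_sq₀ (norm_nonneg _) (norm_nonneg _)).1 h1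

theorem cauchySeq_weightedVec_iff (j : ℕ) (P : ℕ → NCPoly) :
    CauchySeq (fun m => weightedVec j (P m)) ↔ CauchySeq fun m => symNablaPow j (P m) := by
  change _ ↔ CauchySeq fun m => symNablaPowₗ j (P m)
  simp only [Metric.cauchySeq_iff, dist_eq_norm, ← map_sub, norm_weightedVec]

/-! ### Passage to the limit and closability -/

/-- The weighted vectors converge because their differences have the same norms as those of `DᵖP`.
Evaluation at a degree is continuous, so the limit must be the weighted version of `toFock F`. -/
theorem hasSum_norm_of_tendsto {p : ℕ} {F : L2SC} {U : RandomField p} {P : ℕ → NCPoly}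
    (hF : Tendsto (fun m => polyToL2 (P m)) atTop (𝓝 F))
    (hU : Tendsto (fun m => symNablaPow p (P m)) atTop (𝓝 U)) :
    HasSum (fun n => (p.factorial : ℝ) * ((n.descFactorial p : ℝ) * ‖toFock F n‖ ^ 2))
      (‖U‖ ^ 2) := by
  obtain ⟨v, hv⟩ := cauchySeq_tendsto_of_complete
    ((cauchySeq_weightedVec_iff p P).2 hU.cauchySeq)
  have h1 : ∀ n, v n = (chaosWeight p n : ℂ) • toFock F n := by
    intro n
    have h2 := ((lp.evalCLM ℂ (fun n : ℕ => ChaosL2 n) 2 n).continuous.tendsto v).comp hv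
    have h3 := (((lp.evalCLM ℂ (fun n : ℕ => ChaosL2 n) 2 n).continuous.tendsto _).comp
      ((toFock.continuous.tendsto F).comp hF)).const_smul (chaosWeight p n : ℂ)
    refine tendsto_nhds_unique h2 (h3.congr fun m => ?_)
    simp only [Function.comp_apply, toFock_polyToL2]
    rfl
  have h2 : ‖v‖ = ‖U‖ := by
    refine tendsto_nhds_unique hv.norm (hU.norm.congr fun m => ?_)
    exact (norm_weightedVec p (P m)).symm
  have h3 := hasSum_norm_sq v
  simpa only [h1, norm_sq_chaosWeight_smul, h2] using h3

theorem isSymDerivative_iff {p : ℕ} {F : L2SC} {U : RandomField p} :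
    IsSymDerivative p F U ↔ ∃ P : ℕ → NCPoly,
      Tendsto (fun m => polyToL2 (P m)) atTop (𝓝 F) ∧
        Tendsto (fun m => symNablaPow p (P m)) atTop (𝓝 U) := by
  rw [IsSymDerivative, mem_closure_iff_seq_limit]
  constructor
  · rintro ⟨z, hz, hlim⟩
    choose P hP using hz
    obtain rfl : z = fun m => (polyToL2 (P m), symNablaPow p (P m)) := funext hP
    exact ⟨P, (continuous_fst.tendsto _).comp hlim, (continuous_snd.tendsto _).comp hlim⟩
  · rintro ⟨P, h1, h2⟩
    exact ⟨fun m => (polyToL2 (P m), symNablaPow p (P m)), fun m => ⟨P m, rfl⟩,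
      h1.prodMk_nhds h2⟩

/-- Closability: the difference of two approximating sequences tends to `0` in `L²(SC)`, so the norm
formula with `F = 0` forces the limit of its derivatives to vanish. -/
theorem IsSymDerivative.unique {p : ℕ} {F : L2SC} {U V : RandomField p}
    (hU : IsSymDerivative p F U) (hV : IsSymDerivative p F V) : V = U := by
  obtain ⟨P, hP, hPU⟩ := isSymDerivative_iff.1 hU
  obtain ⟨Q, hQ, hQV⟩ := isSymDerivative_iff.1 hV
  have h1 : Tendsto (fun m => polyToL2 (Q m - P m)) atTop (𝓝 0) := by
    simpa only [map_sub, sub_self] using hQ.sub hP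
  have h2 : Tendsto (fun m => symNablaPow p (Q m - P m)) atTop (𝓝 (V - U)) := by
    refine (hQV.sub hPU).congr fun m => ?_
    exact (map_sub (symNablaPowₗ p) (Q m) (P m)).symm
  have h3 := hasSum_norm_of_tendsto h1 h2
  simp only [map_zero, lp.coeFn_zero, Pi.zero_apply, norm_zero, ne_eq, OfNat.ofNat_ne_zero,
    not_false_eq_true, zero_pow, mul_zero] at h3
  have h4 : ‖V - U‖ ^ 2 = 0 := h3.unique hasSum_zero
  exact sub_eq_zero.1 (norm_eq_zero.1 (pow_eq_zero_iff two_ne_zero |>.1 h4))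

/-! ### Wigner integrals of boxes -/

/-- The function `1_{[0,v]} - 1_{[0,u]}`. -/
noncomputable def increment (u v : ℝ) : RealL2 :=
  indicatorConstLp 2 (measurableSet_Icc (a := 0) (b := v)) isCompact_Icc.measure_lt_top.ne 1
    - indicatorConstLp 2 (measurableSet_Icc (a := 0) (b := u)) isCompact_Icc.measure_lt_top.ne 1

theorem coe_brownian_sub (u v : ℝ) :
    ((brownian v - brownian u : SCAlg) : FockOp) = field (increment u v) := by
  rw [increment, field_sub]
  rfl

theorem complexify_increment {u v : ℝ} (hu : 0 ≤ u) (huv : u ≤ v) :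
    complexify (increment u v) =ᵐ[halfLine] (Set.Icc u v).indicator fun _ => (1 : ℂ) := by
  -- `1_{[0,v]} - 1_{[0,u]}` is the indicator of `(u, v]`; it differs from that of `[u, v]` only at
  -- `u`.
  have hne : ∀ᵐ s ∂halfLine, s ≠ u := by
    unfold halfLine
    exact ae_restrict_of_ae (Measure.ae_ne volume u)
  filter_upwards [Complex.ofRealCLM.coeFn_compLp (increment u v),
    Lp.coeFn_sub (indicatorConstLp 2 (measurableSet_Icc (a := 0) (b := v))
      (isCompact_Icc.measure_lt_top (μ := halfLine)).ne (1 : ℝ))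
      (indicatorConstLp 2 (measurableSet_Icc (a := 0) (b := u))
      (isCompact_Icc.measure_lt_top (μ := halfLine)).ne (1 : ℝ)),
    indicatorConstLp_coeFn (p := 2) (hs := measurableSet_Icc (a := 0) (b := v))
      (hμs := (isCompact_Icc.measure_lt_top (μ := halfLine)).ne) (c := (1 : ℝ)),
    indicatorConstLp_coeFn (p := 2) (hs := measurableSet_Icc (a := 0) (b := u))
      (hμs := (isCompact_Icc.measure_lt_top (μ := halfLine)).ne) (c := (1 : ℝ)), hne]
    with s h1 h2 h3 h4 h5
  rw [complexify, h1, increment, h2, Pi.sub_apply, h3, h4]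
  simp only [Set.indicator, Set.mem_Icc, Complex.ofRealCLM_apply]
  rcases lt_or_gt_of_ne h5 with hs | hs
  · by_cases h0 : 0 ≤ s
    · simp [h0, hs.le, hs.le.trans huv, hs.not_ge]
    · simp [h0, hs.not_ge]
  · by_cases hv : s ≤ v <;> simp [hs.le, hs.not_ge, hu.trans hs.le, hv]

theorem inner_increment_eq_zero {u v u' v' : ℝ} (hu : 0 ≤ u) (huv : u ≤ v) (hu' : 0 ≤ u')
    (huv' : u' ≤ v') (hd : ∀ s, s ∈ Set.Icc u v → s ∉ Set.Icc u' v') :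
    inner ℂ (complexify (increment u v)) (complexify (increment u' v')) = 0 := by
  rw [L2.inner_def]
  refine integral_eq_zero_of_ae ?_
  filter_upwards [complexify_increment hu huv, complexify_increment hu' huv'] with s h1 h2
  rw [h1, h2]
  by_cases hs : s ∈ Set.Icc u v
  · simp [Set.indicator_of_notMem (hd s hs)]
  · simp [Set.indicator_of_notMem hs]

theorem boxIndicator_succ {n : ℕ} {u v : Fin (n + 1) → ℝ} (hu : 0 ≤ u) (huv : u ≤ v) :
    boxIndicator u v = consTensor (complexify (increment (u 0) (v 0)))
      (boxIndicator (Fin.tail u) (Fin.tail v)) := by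
  refine Lp.ext ?_
  filter_upwards [indicatorConstLp_coeFn (p := 2) (hs := measurableSet_Icc (a := u) (b := v))
      (hμs := isCompact_Icc.measure_lt_top.ne) (c := (1 : ℂ)) (μ := orthant (n + 1)),
    (memLp_consMul (Lp.memLp (complexify (increment (u 0) (v 0))))
      (Lp.memLp (boxIndicator (Fin.tail u) (Fin.tail v)))).coeFn_toLp,
    consMul_congr_left (boxIndicator (Fin.tail u) (Fin.tail v))
      (complexify_increment (hu 0) (huv 0)),
    consMul_congr ((Set.Icc (u 0) (v 0)).indicator fun _ => (1 : ℂ))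
      (indicatorConstLp_coeFn (p := 2)
        (hs := measurableSet_Icc (a := Fin.tail u) (b := Fin.tail v))
        (hμs := isCompact_Icc.measure_lt_top.ne) (c := (1 : ℂ)) (μ := orthant n))]
    with t h1 h2 h3 h4
  rw [boxIndicator, h1, consTensor, h2, h3, boxIndicator, h4, consMul]
  have h5 : t ∈ Set.Icc u v ↔ t 0 ∈ Set.Icc (u 0) (v 0) ∧
      Fin.tail t ∈ Set.Icc (Fin.tail u) (Fin.tail v) := by
    simp only [Set.mem_Icc, Pi.le_def, Fin.forall_fin_succ, Fin.tail]
    tauto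
  by_cases h6 : t 0 ∈ Set.Icc (u 0) (v 0) <;>
    by_cases h7 : Fin.tail t ∈ Set.Icc (Fin.tail u) (Fin.tail v) <;>
    simp only [Set.indicator, h5, h6, h7, and_self, and_true, and_false, if_true, if_false,
      smul_eq_mul, mul_one, mul_zero]

/-- If two sides of the box shared `s`, the point with both coordinates equal to `s` would lie in
the box and on a diagonal. -/
theorem notMem_Icc_of_injective {ι : Type*} [DecidableEq ι] {u v : ι → ℝ} (huv : u ≤ v)
    (hinj : ∀ t ∈ Set.Icc u v, Function.Injective t) {i j : ι} (hij : i ≠ j) (s : ℝ)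
    (hi : s ∈ Set.Icc (u i) (v i)) : s ∉ Set.Icc (u j) (v j) := by
  intro hj
  have hmem : Function.update (Function.update u i s) j s ∈ Set.Icc u v := by
    refine Set.mem_Icc.2 ⟨fun k => ?_, fun k => ?_⟩ <;>
    · by_cases hkj : k = j
      · subst hkj
        simp [hj.1, hj.2]
      · by_cases hki : k = i
        · subst hki
          simp [hkj, hi.1, hi.2]
        · simp [hkj, hki, huv k]
  refine hij (hinj _ hmem ?_)
  simp [hij]

/-- Each increment acts on an elementary tensor by creating a factor and by contracting with the
adjacent one. The contraction vanishes because the sides of an off-diagonal box are disjoint. -/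
theorem prod_brownian_vacuum {n : ℕ} {u v : Fin n → ℝ} (hu : 0 ≤ u) (huv : u ≤ v)
    (hinj : ∀ t ∈ Set.Icc u v, Function.Injective t) :
    (((List.ofFn fun i => brownian (v i) - brownian (u i)).prod : SCAlg) : FockOp) vacuum
      = lp.single 2 n (boxIndicator u v) := by
  induction n with
  | zero =>
    rw [List.ofFn_zero, List.prod_nil]
    change vacuum = _
    rw [vacuum, boxIndicator]
    congr 2
    ext t
    simp [Set.mem_Icc]
  | succ n ih =>
    have ht : ∀ t ∈ Set.Icc (Fin.tail u) (Fin.tail v), Function.Injective t := by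
      intro t ht
      -- Prepending the endpoint `u 0` lifts a point of the tail box to the full box.
      have h1 : Fin.cons (u 0) t ∈ Set.Icc u v := by
        refine ⟨fun k => ?_, fun k => ?_⟩ <;> refine Fin.cases ?_ (fun k => ?_) k
        · simp
        · exact ht.1 k
        · simpa using huv 0
        · exact ht.2 k
      exact (Fin.cons_injective_iff.1 (hinj _ h1)).2
    have ih' := ih (u := Fin.tail u) (v := Fin.tail v) (fun k => hu k.succ) (fun k => huv k.succ) ht
    rw [List.ofFn_succ, List.prod_cons]
    change ((brownian (v 0) - brownian (u 0) : SCAlg) : FockOp) ((((List.ofFn fun i =>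
      brownian (Fin.tail v i) - brownian (Fin.tail u i)).prod : SCAlg) : FockOp) vacuum) = _
    rw [ih', coe_brownian_sub, boxIndicator_succ hu huv, ← creation_single, field, add_apply,
      add_eq_left]
    cases n with
    | zero => exact adjoint_creation_single_zero _ _
    | succ n =>
      rw [boxIndicator_succ (u := Fin.tail u) (v := Fin.tail v) (fun k => hu k.succ)
        (fun k => huv k.succ), ← creation_single,
        adjoint_creation_creation]
      have h0 : inner ℂ (complexify (increment (u 0) (v 0)))
          (complexify (increment (Fin.tail u 0) (Fin.tail v 0))) = 0 :=
        inner_increment_eq_zero (hu 0) (huv 0) (hu 1) (huv 1)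
          (notMem_Icc_of_injective huv hinj (by simp))
      rw [h0, zero_smul]

theorem exists_poly_of_mem_boxGraph {n : ℕ} {z : ChaosL2 n × L2SC} (hz : z ∈ boxGraph n) :
    ∃ P : NCPoly, polyToL2 P = z.2 ∧ polyVec P = lp.single 2 n z.1 := by
  obtain ⟨u, v, hu, huv, hinj, rfl⟩ := hz
  let e : ℝ → RealL2 := fun t => indicatorConstLp 2 (measurableSet_Icc (a := 0) (b := t))
    isCompact_Icc.measure_lt_top.ne 1
  have h1 : evalPoly (List.ofFn fun i => FreeAlgebra.ι ℂ (e (v i)) - FreeAlgebra.ι ℂ (e (u i))).prod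
      = (List.ofFn fun i => brownian (v i) - brownian (u i)).prod := by
    rw [map_list_prod, List.map_ofFn]
    congr 2
    funext i
    simp only [Function.comp_apply, map_sub, evalPoly, FreeAlgebra.lift_ι_apply]
    rfl
  refine ⟨_, congrArg toL2 h1, ?_⟩
  rw [polyVec_apply, h1]
  exact prod_brownian_vacuum hu huv hinj

/-! ### The Sobolev-Wigner spaces -/

/-- `P ↦ (P(S), (weighted vectors of P)ⱼ)`. -/
noncomputable def graphMap (p : ℕ) : NCPoly →ₗ[ℂ] L2SC × (Fin (p + 1) → Fock) :=
  polyToL2.prod (LinearMap.pi fun j => weightedVec j)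

/-- `(f, X) ↦ (X, (weighted vectors of f)ⱼ)` for `f` in the `n`-th chaos. -/
noncomputable def chaosMap (p n : ℕ) : ChaosL2 n × L2SC →L[ℂ] L2SC × (Fin (p + 1) → Fock) :=
  (ContinuousLinearMap.snd ℂ _ _).prod (ContinuousLinearMap.pi fun j =>
    (chaosWeight j n : ℂ) • (lp.singleContinuousLinearMap ℂ (fun n : ℕ => ChaosL2 n) 2 n).comp
      (ContinuousLinearMap.fst ℂ _ _))

/-- Within one chaos every weight is a constant, so `chaosMap` is continuous. It sends box pairs
into the range of `graphMap`, hence the closed span of boxes into the closure of that range. -/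
theorem chaosMap_mem_of_isWignerIntegral (p : ℕ) {n : ℕ} {f : ChaosL2 n} {X : L2SC}
    (h : IsWignerIntegral n f X) :
    chaosMap p n (f, X) ∈ (LinearMap.range (graphMap p)).topologicalClosure := by
  refine map_mem_closure (chaosMap p n).continuous h ?_
  change Submodule.span ℂ (boxGraph n) ≤
    (LinearMap.range (graphMap p)).comap (chaosMap p n).toLinearMap
  refine Submodule.span_le.2 fun z hz => ?_
  obtain ⟨P, h1, h2⟩ := exists_poly_of_mem_boxGraph hz
  refine ⟨P, Prod.ext h1 (funext fun j => ?_)⟩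
  change weightedVec j P = (chaosWeight j n : ℂ) • lp.single 2 n z.1
  ext1
  funext m
  rw [weightedVec_apply, h2, lp.coeFn_smul, Pi.smul_apply]
  by_cases hm : m = n
  · rw [hm]
  · rw [lp.single_apply_ne _ _ _ hm, smul_zero, smul_zero]

theorem toFock_of_isWignerIntegral {n : ℕ} {f : ChaosL2 n} {X : L2SC}
    (h : IsWignerIntegral n f X) : toFock X = lp.single 2 n f := by
  have hc : IsClosed {z : ChaosL2 n × L2SC | toFock z.2 = lp.single 2 n z.1} :=
    isClosed_eq (toFock.continuous.comp continuous_snd)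
      ((lp.singleContinuousLinearMap ℂ (fun n : ℕ => ChaosL2 n) 2 n).continuous.comp
        continuous_fst)
  refine closure_minimal (t := {z : ChaosL2 n × L2SC | toFock z.2 = lp.single 2 n z.1})
    (fun z hz => ?_) hc h
  induction hz using Submodule.span_induction with
  | mem z hz =>
    obtain ⟨P, h1, h2⟩ := exists_poly_of_mem_boxGraph hz
    rw [Set.mem_ofPred_eq, ← h1, toFock_polyToL2, h2]
  | zero => simp
  | add x y _ _ hx hy =>
    simp only [Set.mem_ofPred_eq, Prod.snd_add, Prod.fst_add, map_add, lp.single_add] at *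
    rw [hx, hy]
  | smul c x _ hx =>
    simp only [Set.mem_ofPred_eq, Prod.smul_snd, Prod.smul_fst, map_smul, lp.single_smul] at *
    rw [hx]

theorem toFock_apply_of_hasSum {F : L2SC} {f : (n : ℕ) → ChaosL2 n} {X : ℕ → L2SC}
    (hX : ∀ n, IsWignerIntegral n (f n) (X n)) (hF : HasSum X F) (n : ℕ) : toFock F n = f n := by
  have h1 := (hF.mapL toFock).mapL (lp.evalCLM ℂ (fun n : ℕ => ChaosL2 n) 2 n)
  refine h1.unique ?_
  convert hasSum_ite_eq n (f n) using 2 with m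
  rw [toFock_of_isWignerIntegral (hX m)]
  change lp.single 2 m (f m) n = _
  split_ifs with hm
  · subst hm
    rw [lp.single_apply_self]
  · rw [lp.single_apply_ne _ _ _ (Ne.symm hm)]

/-! ### Sufficiency of the summability condition -/

theorem descFactorial_le_descFactorial {j p n : ℕ} (hjp : j ≤ p) (hpn : p ≤ n) :
    n.descFactorial j ≤ n.descFactorial p := by
  rw [← Nat.descFactorial_mul_descFactorial hjp]
  exact Nat.le_mul_of_pos_left _ (Nat.descFactorial_pos.2 (by omega))

theorem summable_descFactorial_mul_of_le {a : ℕ → ℝ} (ha : ∀ n, 0 ≤ a n) {j p : ℕ} (hjp : j ≤ p)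
    (h : Summable fun n : ℕ => ((n + p).descFactorial p : ℝ) * a (n + p)) :
    Summable fun n : ℕ => (n.descFactorial j : ℝ) * a n := by
  refine (summable_nat_add_iff p).1 (Summable.of_nonneg_of_le (fun n => ?_) (fun n => ?_) h)
  · exact mul_nonneg (Nat.cast_nonneg _) (ha _)
  · exact mul_le_mul_of_nonneg_right
      (Nat.cast_le.2 (descFactorial_le_descFactorial hjp (by omega))) (ha _)

/-- One sequence of polynomials must serve every order `j ≤ p`. The approximation is therefore made
in the product of `L²(SC)` with all the weighted Fock spaces; the extra index `j = 0` has weight `1`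
and is harmless. -/
theorem mem_sobolevWigner_of_summable {p : ℕ} {F : L2SC} {f : (n : ℕ) → ChaosL2 n} {X : ℕ → L2SC}
    (hX : ∀ n, IsWignerIntegral n (f n) (X n)) (hF : HasSum X F)
    (h : Summable fun n : ℕ => ((n + p).descFactorial p : ℝ) * ‖f (n + p)‖ ^ 2) :
    F ∈ SobolevWigner p := by
  have hmem : ∀ j : Fin (p + 1), Memℓp (fun n => (chaosWeight j n : ℂ) • f n) 2 := by
    intro j
    refine memℓp_of_summable_sq ?_
    simp only [norm_sq_chaosWeight_smul]
    exact (summable_descFactorial_mul_of_le (a := fun n => ‖f n‖ ^ 2) (fun n => by positivity)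
      (Nat.lt_succ_iff.1 j.2) h).mul_left _
  let V : Fin (p + 1) → Fock := fun j => ⟨_, hmem j⟩
  have hV : HasSum (fun n => chaosMap p n (f n, X n)) (F, V) := by
    refine hF.prodMk (Pi.hasSum.2 fun j => ?_)
    convert lp.hasSum_single (by norm_num) (V j) using 2 with n
    exact (lp.single_smul 2 n (chaosWeight j n : ℂ) (f n)).symm
  -- The partial sums over `n` stay in a closed subspace, so their limit does too.
  have hcl : (F, V) ∈ (LinearMap.range (graphMap p)).topologicalClosure :=
    (LinearMap.range (graphMap p)).isClosed_topologicalClosure.mem_of_tendsto hV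
      (Eventually.of_forall fun s => Submodule.sum_mem _ fun n _ =>
        chaosMap_mem_of_isWignerIntegral p (hX n))
  obtain ⟨z, hz, hlim⟩ := mem_closure_iff_seq_limit.1 hcl
  choose P hP using hz
  obtain rfl : z = fun m => graphMap p (P m) := funext fun m => (hP m).symm
  refine ⟨P, (continuous_fst.tendsto _).comp hlim, fun j hj => ?_⟩
  have hj' : j < p + 1 := Nat.lt_succ_iff.2 (Finset.mem_Icc.1 hj).2
  have h2 : Tendsto (fun m => weightedVec j (P m)) atTop (𝓝 (V ⟨j, hj'⟩)) :=
    (((continuous_apply (⟨j, hj'⟩ : Fin (p + 1))).comp continuous_snd).tendsto _).comp hlim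
  exact (cauchySeq_weightedVec_iff j P).1 h2.cauchySeq

theorem exists_tendsto_of_mem_sobolevWigner {p : ℕ} (hp : 1 ≤ p) {F : L2SC}
    (hF : F ∈ SobolevWigner p) : ∃ (P : ℕ → NCPoly) (U : RandomField p),
      Tendsto (fun m => polyToL2 (P m)) atTop (𝓝 F) ∧
        Tendsto (fun m => symNablaPow p (P m)) atTop (𝓝 U) := by
  obtain ⟨P, h1, h2⟩ := hF
  obtain ⟨U, hU⟩ := cauchySeq_tendsto_of_complete (h2 p (Finset.mem_Icc.2 ⟨hp, le_rfl⟩))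
  exact ⟨P, U, h1, hU⟩

end Wigner

theorem mainTheorem6 (p : ℕ) (hp : 1 ≤ p) (F : Wigner.L2SC) (f : (n : ℕ) → Wigner.ChaosL2 n)
    (X : ℕ → Wigner.L2SC) (hX : ∀ n, Wigner.IsWignerIntegral n (f n) (X n)) (hF : HasSum X F) :
    (F ∈ Wigner.SobolevWigner p ↔
      Summable fun n : ℕ => ((n + p).descFactorial p : ℝ) * ‖f (n + p)‖ ^ 2) ∧
    (F ∈ Wigner.SobolevWigner p →
      ∃ U : Wigner.RandomField p,
        (∀ V : Wigner.RandomField p, Wigner.IsSymDerivative p F V ↔ V = U) ∧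
        HasSum (fun n : ℕ => (p.factorial : ℝ) * (((n + p).descFactorial p : ℝ) * ‖f (n + p)‖ ^ 2))
          (‖U‖ ^ 2)) := by
  have key : F ∈ Wigner.SobolevWigner p → ∃ U : Wigner.RandomField p,
      (∀ V : Wigner.RandomField p, Wigner.IsSymDerivative p F V ↔ V = U) ∧
      HasSum (fun n : ℕ => (p.factorial : ℝ) * (((n + p).descFactorial p : ℝ) * ‖f (n + p)‖ ^ 2))
        (‖U‖ ^ 2) := by
    intro h
    obtain ⟨P, U, h1, h2⟩ := Wigner.exists_tendsto_of_mem_sobolevWigner hp h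
    have hU : Wigner.IsSymDerivative p F U := Wigner.isSymDerivative_iff.2 ⟨P, h1, h2⟩
    refine ⟨U, fun V => ⟨fun hV => hU.unique hV, fun hV => hV ▸ hU⟩, ?_⟩
    have h3 := Wigner.hasSum_norm_of_tendsto h1 h2
    simp only [Wigner.toFock_apply_of_hasSum hX hF] at h3
    -- The terms with `n < p` carry a zero `descFactorial`, so the series may start at `p`.
    rw [← hasSum_nat_add_iff' p, Finset.sum_eq_zero, sub_zero] at h3
    · exact h3
    · intro n hn
      rw [Nat.descFactorial_eq_zero_iff_lt.2 (Finset.mem_range.1 hn)]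
      simp
  refine ⟨⟨fun h => ?_, Wigner.mem_sobolevWigner_of_summable hX hF⟩, key⟩
  obtain ⟨U, -, hU⟩ := key h
  exact (summable_mul_left_iff (Nat.cast_ne_zero.2 p.factorial_ne_zero)).1 hU.summable
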